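/- Conventions. Rings are commutative with $1$. A real (ring) valuation on a ring $R$ is a map $v\colon R\to\mathbb{R}\cup\{\infty\}$ such that $v(fg)=v(f)+v(g)$ and $v(f+g)\ge\min\{v(f),v(g)\}$ for all $f,g\in R$, $v(0)=\infty$ and $v(1)=0$; nonzero elements may have value $\infty$. It is nonnegative if $v(f)\ge 0$ for all $f\in R$. If $(R,\mathfrak{m})$ is a local ring, $v$ is called local if it is nonnegative on $R$ and $v(f)>0$ for all $f\in\mathfrak{m}$. Theorem. Let $(R,\mathfrak{m})$ and $(S,\mathfrak{n})$ be local rings with $R\subseteq S$ and $\mathfrak{n}\cap R=\mathfrak{m}$, and let $v$ be a nonnegative real valuation on $R$. Assume that one of the following conditions holds: (a) $S$ is an integral extension of $R$; (b) $R$ and $S$ are Noetherian and complete with respect to the $\mathfrak{m}$-adic and the $\mathfrak{n}$-adic topology, respectively, and (i) $S$ is flat over $R$, (ii) the natural map of residue fields $R/\mathfrak{m}\to S/\mathfrak{n}$ is an isomorphism, and (iii) the ideal $\mathfrak{m}S$ is prime in $S$. Then there is a nonnegative real valuation $w$ on $S$ whose restriction to $R$ is $v$. If, moreover, $v$ is local,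 then $w$ can be chosen to be local. In case (a), every real valuation $w$ on $S$ whose restriction to $R$ is $v$ is nonnegative, and it is local if $v$ is local. -/

import Mathlib

/-- A real (ring) valuation on a commutative ring `R`: a map `v : R → ℝ ∪ {∞}` with
`v (f * g) = v f + v g`, `v 0 = ∞`, `v 1 = 0` and `min (v f) (v g) ≤ v (f + g)`.
Nonzero elements may take the value `∞`, and negative values are allowed. -/
abbrev RealValuation (R : Type*) [CommRing R] : Type _ :=
  AddValuation R (WithTop ℝ)

namespace RealValuation

/-- The valuation is nonnegative on the whole ring (it is centered in `R`). -/
def IsNonneg {R : Type*} [CommRing R] (v : RealValuation R) : Prop :=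
  ∀ f : R, 0 ≤ v f

/-- A local valuation of a local ring: nonnegative on the ring and (strictly) positive on the
maximal ideal. -/
def IsLocal {R : Type*} [CommRing R] [IsLocalRing R] (v : RealValuation R) : Prop :=
  IsNonneg v ∧ ∀ f ∈ IsLocalRing.maximalIdeal R, 0 < v f

/-- The valuation `w` of `S` extends the valuation `v` of `R`: its restriction to `R` is `v`. -/
def Extends {R S : Type*} [CommRing R] [CommRing S] [Algebra R S]
    (w : RealValuation S) (v : RealValuation R) : Prop :=
  ∀ r : R, w (algebraMap R S r) = v r

end RealValuation

/-! The support p of v is prime. It suffices to find a prime q of S over p with S/q integral over R: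
v then induces a valuation of Frac(R/p), which extends to the algebraic extension Frac(S/q) and
pulls back to S. Integrality of S/q forces nonnegativity and, for local v, positivity on the maximal
ideal, whichever extension to S/q was chosen.

In case (a), q exists by lying over. In case (b), flatness gives going down, which passes to R/p →
S/pS. Cutting S/pS by lifts of parameters of the closed fibre leaves a ring C of dimension at least
dim R/p with zero-dimensional closed fibre. Since R is complete and the residue field does not grow,
C is finite over R (`IsLocalRing.finite_of_isPrecomplete`). The dimension bound makes R/p → C
injective, so some prime Q of C lies over 0, and q is the preimage of Q in S. -/

open scoped NNReal

/-! ### Extending valuations along algebraic field extensions -/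

/-- A nonarchimedean absolute value on a field extends to every algebraic extension. -/
theorem AbsoluteValue.exists_isNonarchimedean_extension {K L : Type*} [Field K] [Field L]
    [Algebra K L] [Algebra.IsAlgebraic K L] (μ : AbsoluteValue K ℝ) (hμ : IsNonarchimedean μ) :
    ∃ ν : AbsoluteValue L ℝ, IsNonarchimedean ν ∧ ∀ x : K, ν (algebraMap K L x) = μ x := by
  classical
  -- The trivial absolute value is treated apart: the completion is a `NontriviallyNormedField` only
  -- if some element has absolute value above 1.
  by_cases htriv : ∀ x, x ≠ 0 → μ x ≤ 1
  · refine ⟨AbsoluteValue.trivial, fun x y ↦ ?_, fun x ↦ ?_⟩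
    · by_cases hx : x = 0 <;> by_cases hy : y = 0 <;> by_cases hxy : x + y = 0 <;> simp_all
    · by_cases hx : x = 0
      · simp [hx]
      · have h1 := htriv x hx
        have h2 := htriv x⁻¹ (inv_ne_zero hx)
        have h3 : 0 < μ x := μ.pos hx
        rw [map_inv₀, inv_le_one₀ h3] at h2
        simp [hx, le_antisymm h1 h2]
  · push Not at htriv
    obtain ⟨π, -, hπ⟩ := htriv
    let F := μ.Completion
    have hnorm (x : K) : ‖((WithAbs.toAbs μ x : WithAbs μ) : F)‖ = μ x :=
      UniformSpace.Completion.norm_coe _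
    let _ : NontriviallyNormedField F :=
      { (inferInstance : NormedField F) with
        non_trivial := ⟨((WithAbs.toAbs μ π : WithAbs μ) : F), by
          change 1 < ‖((WithAbs.toAbs μ π : WithAbs μ) : F)‖
          rwa [hnorm]⟩ }
    have : IsUltrametricDist F := by
      apply IsUltrametricDist.isUltrametricDist_of_isNonarchimedean_norm
      intro x y
      induction x, y using UniformSpace.Completion.induction_on₂ with
      | hp => exact isClosed_le (by fun_prop) (by fun_prop)
      | ih a b =>
        rw [← UniformSpace.Completion.coe_add, UniformSpace.Completion.norm_coe,
          UniformSpace.Completion.norm_coe, UniformSpace.Completion.norm_coe]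
        exact hμ a.ofAbs b.ofAbs
    let φ : K →+* AlgebraicClosure F := (algebraMap F (AlgebraicClosure F)).comp
      ((UniformSpace.Completion.coeRingHom : WithAbs μ →+* F).comp
        (WithAbs.equiv μ).symm.toRingHom)
    let _ : Algebra K (AlgebraicClosure F) := φ.toAlgebra
    -- Over the complete field `F` the spectral norm on the algebraic closure is multiplicative; it
    -- is restricted to L along an embedding over K.
    let ψ : L →ₐ[K] AlgebraicClosure F := IsAlgClosed.lift
    refine ⟨{ toFun := fun x ↦ spectralMulAlgNorm F (AlgebraicClosure F) (ψ x)
              map_mul' := fun x y ↦ by simp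
              nonneg' := fun x ↦ apply_nonneg _ _
              eq_zero' := fun x ↦ by
                rw [map_eq_zero_iff_eq_zero, map_eq_zero]
              add_le' := fun x y ↦ by
                rw [map_add]
                exact map_add_le_add _ _ _ }, fun x y ↦ ?_, fun x ↦ ?_⟩
    · change spectralNorm F (AlgebraicClosure F) (ψ (x + y)) ≤ _
      rw [map_add]
      exact isNonarchimedean_spectralNorm _ _
    · change spectralNorm F (AlgebraicClosure F) (ψ (algebraMap K L x)) = _
      rw [AlgHom.commutes]
      exact (spectralNorm_extends _).trans (hnorm x)

/-- A valuation with values in `ℝ≥0` on a field extends to every algebraic extension. -/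
theorem Valuation.exists_nnreal_extension {K L : Type*} [Field K] [Field L]
    [Algebra K L] [Algebra.IsAlgebraic K L] (μ : Valuation K ℝ≥0) :
    ∃ ν : Valuation L ℝ≥0, ∀ x : K, ν (algebraMap K L x) = μ x := by
  obtain ⟨ν, hν, h⟩ := AbsoluteValue.exists_isNonarchimedean_extension (L := L)
    { toFun := fun x : K ↦ (μ x : ℝ)
      map_mul' := fun x y ↦ by simp
      nonneg' := fun x ↦ NNReal.coe_nonneg _
      eq_zero' := fun x ↦ by simp
      add_le' := fun x y ↦ by
        have := μ.map_add x y
        exact_mod_cast this.trans (max_le_add_of_nonneg zero_le zero_le) }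
    (fun x y ↦ by
      have := μ.map_add x y
      exact_mod_cast this)
  refine ⟨{ toFun := fun x ↦ ⟨ν x, ν.nonneg x⟩
            map_zero' := NNReal.eq (map_zero ν)
            map_one' := NNReal.eq (map_one ν)
            map_mul' := fun x y ↦ NNReal.eq (map_mul ν x y)
            map_add_le_max' := fun x y ↦ by
              have := hν x y
              exact_mod_cast this }, fun x ↦ ?_⟩
  ext
  exact h x

/-- A valuation with values in `ℝ≥0` on `R` extends along a ring homomorphism `R → S` as soon as
its support is the contraction of a prime `q` of `S` such that `S ⧸ q` is integral over `R`. -/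
theorem Valuation.exists_nnreal_extension_of_isIntegral_quotient {R S : Type*} [CommRing R]
    [CommRing S] [Algebra R S] (μ : Valuation R ℝ≥0) (q : Ideal S) [q.IsPrime]
    (hq : q.comap (algebraMap R S) = μ.supp) [Algebra.IsIntegral R (S ⧸ q)] :
    ∃ ν : Valuation S ℝ≥0, ∀ r : R, ν (algebraMap R S r) = μ r := by
  let p : Ideal R := μ.supp
  have hp : p.IsPrime := inferInstance
  let μ' : Valuation (R ⧸ p) ℝ≥0 := μ.onQuot le_rfl
  have hμ' : nonZeroDivisors (R ⧸ p) ≤ μ'.supp.primeCompl := by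
    intro x hx hx'
    rw [Valuation.supp_quot_supp] at hx'
    exact nonZeroDivisors.ne_zero hx (by simpa using hx')
  let _ : Algebra (R ⧸ p) (S ⧸ q) := Ideal.Quotient.algebraQuotientOfLEComap hq.ge
  have : IsScalarTower R (R ⧸ p) (S ⧸ q) := IsScalarTower.of_algebraMap_eq fun _ ↦ rfl
  have : Algebra.IsIntegral (R ⧸ p) (S ⧸ q) := Algebra.IsIntegral.tower_top R
  have hinj : Function.Injective (algebraMap (R ⧸ p) (S ⧸ q)) :=
    Ideal.quotientMap_injective' hq.le
  have : FaithfulSMul (R ⧸ p) (S ⧸ q) := (faithfulSMul_iff_algebraMap_injective _ _).2 hinj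
  let K := FractionRing (R ⧸ p)
  let L := FractionRing (S ⧸ q)
  let _ : Algebra K L := FractionRing.liftAlgebra (R ⧸ p) L
  have : IsScalarTower (R ⧸ p) K L := FractionRing.isScalarTower_liftAlgebra _ _
  have : Algebra.IsAlgebraic K L := by
    have : Algebra.IsAlgebraic (R ⧸ p) L :=
      (IsFractionRing.isAlgebraic_iff' (R ⧸ p) (S ⧸ q) L).1 inferInstance
    exact IsFractionRing.comap_isAlgebraic_iff.1 this
  obtain ⟨ν, hν⟩ := (μ'.extendToLocalization hμ' K).exists_nnreal_extension (L := L)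
  refine ⟨ν.comap ((algebraMap (S ⧸ q) L).comp (Ideal.Quotient.mk q)), fun r ↦ ?_⟩
  have key : algebraMap (S ⧸ q) L (Ideal.Quotient.mk q (algebraMap R S r)) =
      algebraMap K L (algebraMap (R ⧸ p) K (Ideal.Quotient.mk p r)) := by
    rw [← IsScalarTower.algebraMap_apply (R ⧸ p) K L,
      IsScalarTower.algebraMap_apply (R ⧸ p) (S ⧸ q) L]
    rfl
  rw [Valuation.comap_apply, RingHom.comp_apply, key, hν,
    Valuation.extendToLocalization_apply_map_apply]
  rfl

/-! ### Additive and multiplicative forms of a valuation -/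

/-- The order-reversing map `a ↦ exp (-a)` from `ℝ ∪ {∞}` to `ℝ≥0`. -/
noncomputable def WithTop.expNeg : WithTop ℝ → ℝ≥0
  | ⊤ => 0
  | (a : ℝ) => ⟨Real.exp (-a), (Real.exp_pos _).le⟩

/-- The order-reversing map `t ↦ -log t` from `ℝ≥0` to `ℝ ∪ {∞}`. -/
noncomputable def NNReal.negLog (t : ℝ≥0) : WithTop ℝ :=
  if t = 0 then ⊤ else ((-Real.log t : ℝ) : WithTop ℝ)

theorem WithTop.expNeg_coe (a : ℝ) : ((a : WithTop ℝ).expNeg : ℝ) = Real.exp (-a) := rfl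

theorem WithTop.expNeg_top : (⊤ : WithTop ℝ).expNeg = 0 := rfl

theorem WithTop.expNeg_add (a b : WithTop ℝ) : (a + b).expNeg = a.expNeg * b.expNeg := by
  induction a with
  | top => simp [expNeg_top]
  | coe a =>
    induction b with
    | top => simp [expNeg_top]
    | coe b =>
      ext
      rw [← WithTop.coe_add, NNReal.coe_mul, expNeg_coe, expNeg_coe, expNeg_coe, ← Real.exp_add,
        neg_add]

theorem WithTop.expNeg_antitone : Antitone WithTop.expNeg := by
  intro a b hab
  induction b with
  | top => simp [expNeg_top]
  | coe b =>
    induction a with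
    | top => simp at hab
    | coe a =>
      rw [← NNReal.coe_le_coe, expNeg_coe, expNeg_coe]
      have : a ≤ b := by exact_mod_cast hab
      gcongr

theorem NNReal.negLog_mul (s t : ℝ≥0) : (s * t).negLog = s.negLog + t.negLog := by
  by_cases hs : s = 0
  · simp [negLog, hs]
  by_cases ht : t = 0
  · simp [negLog, ht]
  have : Real.log ((s * t : ℝ≥0) : ℝ) = Real.log s + Real.log t := by
    rw [NNReal.coe_mul, Real.log_mul (by simpa using hs) (by simpa using ht)]
  simp only [negLog, mul_eq_zero, hs, ht, or_self, if_false, this]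
  rw [← WithTop.coe_add, neg_add]

theorem NNReal.negLog_antitone : Antitone NNReal.negLog := by
  intro s t hst
  by_cases hs : s = 0
  · simp [negLog, hs]
  have ht : t ≠ 0 := fun h ↦ hs (by simpa [h] using hst)
  have hs' : (0 : ℝ) < s := by exact_mod_cast pos_iff_ne_zero.2 hs
  simp only [negLog, hs, ht, if_false, WithTop.coe_le_coe, neg_le_neg_iff]
  exact Real.log_le_log hs' (by exact_mod_cast hst)

theorem NNReal.negLog_expNeg (a : WithTop ℝ) : a.expNeg.negLog = a := by
  induction a with
  | top => simp [WithTop.expNeg_top, negLog]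
  | coe a =>
    have h : (a : WithTop ℝ).expNeg ≠ 0 := by
      rw [← NNReal.coe_ne_zero, WithTop.expNeg_coe]
      exact (Real.exp_pos _).ne'
    rw [negLog, if_neg h, WithTop.expNeg_coe, Real.log_exp, neg_neg]

namespace RealValuation

variable {R S : Type*} [CommRing R] [CommRing S]

/-- The multiplicative form `exp (-v)` of a real valuation `v`. -/
noncomputable def toNNReal (v : RealValuation R) : Valuation R ℝ≥0 where
  toFun f := (v f).expNeg
  map_zero' := by rw [v.map_zero, WithTop.expNeg_top]
  map_one' := by
    ext
    rw [v.map_one, ← WithTop.coe_zero, WithTop.expNeg_coe, neg_zero, Real.exp_zero, NNReal.coe_one]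
  map_mul' f g := by rw [v.map_mul, WithTop.expNeg_add]
  map_add_le_max' f g := by
    rw [← WithTop.expNeg_antitone.map_min]
    exact WithTop.expNeg_antitone (v.map_add f g)

/-- The additive form `-log μ` of a valuation `μ` with values in `ℝ≥0`. -/
noncomputable def ofNNReal (μ : Valuation R ℝ≥0) : RealValuation R :=
  AddValuation.of (fun f ↦ (μ f).negLog) (by simp [NNReal.negLog]) (by simp [NNReal.negLog])
    (fun f g ↦ by
      rw [← NNReal.negLog_antitone.map_max]
      exact NNReal.negLog_antitone (μ.map_add f g))
    (fun f g ↦ by rw [μ.map_mul, NNReal.negLog_mul])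

theorem supp_toNNReal (v : RealValuation R) : (toNNReal v).supp = v.supp := by
  ext f
  rw [Valuation.mem_supp_iff, AddValuation.mem_supp_iff]
  change (v f).expNeg = 0 ↔ v f = ⊤
  constructor
  · intro h
    rw [← NNReal.negLog_expNeg (v f), h]
    simp [NNReal.negLog]
  · intro h
    rw [h, WithTop.expNeg_top]

theorem isPrime_supp (v : RealValuation R) : v.supp.IsPrime :=
  supp_toNNReal v ▸ inferInstance

/-- A real valuation on `R` extends to `S` as soon as its support is the contraction of a prime
`q` of `S` such that `S ⧸ q` is integral over `R`; the extension can be chosen to factor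
through `S ⧸ q`. -/
theorem exists_extends_of_isIntegral_quotient [Algebra R S] (v : RealValuation R)
    (q : Ideal S) [q.IsPrime] (hq : q.comap (algebraMap R S) = v.supp)
    [Algebra.IsIntegral R (S ⧸ q)] :
    ∃ w : RealValuation (S ⧸ q), Extends w v := by
  -- The zero ideal of S/q plays the role of q, so that the extension lives on S/q, which is
  -- integral over R even when S is not.
  have : Ideal.comap (algebraMap R (S ⧸ q)) ⊥ = (toNNReal v).supp := by
    rw [supp_toNNReal, ← hq, IsScalarTower.algebraMap_eq R S (S ⧸ q), ← Ideal.comap_comap]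
    congr 1
    exact Ideal.mk_ker
  have : Algebra.IsIntegral R ((S ⧸ q) ⧸ (⊥ : Ideal (S ⧸ q))) :=
    Algebra.IsIntegral.of_surjective (IsScalarTower.toAlgHom R (S ⧸ q) _)
      Ideal.Quotient.mk_surjective
  obtain ⟨ν, hν⟩ := (toNNReal v).exists_nnreal_extension_of_isIntegral_quotient
    (⊥ : Ideal (S ⧸ q)) ‹_›
  refine ⟨ofNNReal ν, fun r ↦ ?_⟩
  change (ν (algebraMap R (S ⧸ q) r)).negLog = v r
  rw [hν]
  exact NNReal.negLog_expNeg _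

/-! ### Nonnegativity and locality along integral extensions -/

theorem toNNReal_le_one_iff (v : RealValuation R) (f : R) : toNNReal v f ≤ 1 ↔ 0 ≤ v f := by
  have h1 : (0 : WithTop ℝ).expNeg = 1 := (toNNReal v).map_one ▸ by
    change _ = (v 1).expNeg
    rw [v.map_one]
  refine ⟨fun h ↦ ?_, fun h ↦ h1 ▸ WithTop.expNeg_antitone h⟩
  have := NNReal.negLog_antitone (h.trans_eq h1.symm)
  rw [NNReal.negLog_expNeg] at this
  exact this.trans_eq (NNReal.negLog_expNeg (v f))

/-- A real valuation on an integral extension is nonnegative if its restriction is. -/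
theorem IsNonneg.of_extends [Algebra R S] [Algebra.IsIntegral R S]
    {v : RealValuation R} (hv : IsNonneg v) {w : RealValuation S} (hw : Extends w v) :
    IsNonneg w := by
  intro s
  obtain ⟨P, hP, hs⟩ := Algebra.IsIntegral.isIntegral (R := R) s
  -- The integral equation of s has coefficients in the valuation ring of w, which is integrally
  -- closed.
  let ι : R →+* (toNNReal w).integer := (algebraMap R S).codRestrict _ fun r ↦
    (toNNReal_le_one_iff w _).2 (hw r ▸ hv r)
  have : IsIntegral (toNNReal w).integer s :=
    ⟨P.map ι, hP.map ι, by rw [Polynomial.eval₂_map]; exact hs⟩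
  exact (toNNReal_le_one_iff w s).1
    ((Valuation.integer.integers (toNNReal w)).isIntegral_iff_v_le_one.1 this)

/-- Under an integral homomorphism of local rings, a real valuation is local if its restriction
is. -/
theorem IsLocal.of_extends [Algebra R S] [Algebra.IsIntegral R S] [IsLocalRing R] [IsLocalRing S]
    {v : RealValuation R} (hv : IsLocal v) {w : RealValuation S} (hw : Extends w v) :
    IsLocal w := by
  have hnn := hv.1.of_extends hw
  refine ⟨hnn, fun f hf ↦ ?_⟩
  -- A prime containing 𝔪S contracts to 𝔪, so by integrality it is maximal, hence equal to 𝔫.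
  have hrad : f ∈ ((IsLocalRing.maximalIdeal R).map (algebraMap R S)).radical := by
    rw [Ideal.radical_eq_sInf, Submodule.mem_sInf]
    rintro P ⟨hP, hPp⟩
    have hmax : (Ideal.comap (algebraMap R S) P).IsMaximal := by
      rw [← (IsLocalRing.maximalIdeal.isMaximal R).eq_of_le
        (Ideal.IsPrime.comap _).ne_top (Ideal.map_le_iff_le_comap.1 hP)]
      infer_instance
    have := Ideal.isMaximal_of_isIntegral_of_isMaximal_comap P hmax
    rwa [IsLocalRing.eq_maximalIdeal this]
  obtain ⟨n, hn⟩ := hrad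
  have hpos : ∀ g ∈ (IsLocalRing.maximalIdeal R).map (algebraMap R S), 0 < w g := by
    intro g hg
    induction hg using Submodule.span_induction with
    | mem x hx =>
      obtain ⟨r, hr, rfl⟩ := hx
      exact hw r ▸ hv.2 r hr
    | zero => simp
    | add x y _ _ hx hy => exact (lt_min hx hy).trans_le (w.map_add x y)
    | smul a x _ hx =>
      rw [smul_eq_mul, w.map_mul]
      exact hx.trans_le (le_add_of_nonneg_left (hnn a))
  have h := hpos _ hn
  rw [w.map_pow] at h
  exact lt_of_le_of_ne (hnn f) fun h0 ↦ by simp [← h0] at h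

end RealValuation

/-! ### Finiteness over a complete local ring -/

open IsLocalRing

/-- The submodule `I • ⊤` of a finite power of `R` contains every vector with coordinates
in `I`. -/
theorem Ideal.mem_smul_top_of_forall_mem {R : Type*} [CommRing R] {ι : Type*} [Finite ι]
    {I : Ideal R} {x : ι → R} (hx : ∀ i, x i ∈ I) : x ∈ (I • ⊤ : Submodule R (ι → R)) := by
  classical
  cases nonempty_fintype ι
  rw [pi_eq_sum_univ' x]
  exact Submodule.sum_mem _ fun i _ ↦ Submodule.smul_mem_smul (hx i) trivial

/-- A finite power of an `I`-adically precomplete ring is `I`-adically precomplete. -/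
theorem IsPrecomplete.pi {R : Type*} [CommRing R] (I : Ideal R) [IsPrecomplete I R]
    (ι : Type*) [Finite ι] : IsPrecomplete I (ι → R) := by
  refine ⟨fun f hf ↦ ?_⟩
  have hcoord (J : Ideal R) (x : ι → R) (i : ι) (hx : x ∈ (J • ⊤ : Submodule R (ι → R))) :
      x i ∈ (J • ⊤ : Submodule R R) := by
    have := Submodule.mem_map_of_mem (f := LinearMap.proj (R := R) (φ := fun _ : ι ↦ R) i) hx
    rw [Submodule.map_smul''] at this
    exact Submodule.smul_mono le_rfl le_top this
  have h (i : ι) : ∃ L : R, ∀ n, f n i ≡ L [SMOD (I ^ n • ⊤ : Submodule R R)] :=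
    IsPrecomplete.prec ‹_› fun {m n} hmn ↦ by
      have := hcoord _ _ i (SModEq.sub_mem.1 (hf hmn))
      exact SModEq.sub_mem.2 this
  choose L hL using h
  refine ⟨L, fun n ↦ SModEq.sub_mem.2 (Ideal.mem_smul_top_of_forall_mem fun i ↦ ?_)⟩
  simpa using SModEq.sub_mem.1 (hL i n)

/-- A module that is Hausdorff for the `I`-adic topology over an `I`-adically complete ring is
finite if it is finite modulo `I`. -/
theorem Module.Finite.of_isPrecomplete_of_isHausdorff {R M : Type*} [CommRing R] [AddCommGroup M]
    [Module R M] (I : Ideal R) [IsPrecomplete I R] [IsHausdorff I M] (N : Submodule R M)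
    (hN : N.FG) (h : N ⊔ I • ⊤ = ⊤) : Module.Finite R M := by
  obtain ⟨n, s, hs⟩ := Submodule.fg_iff_exists_fin_generating_family.1 hN
  have := IsPrecomplete.pi I (Fin n)
  have hsurj : Function.Surjective (Fintype.linearCombination R s) := by
    -- Successive approximation: surjectivity modulo I lifts because the source is precomplete and
    -- the target Hausdorff.
    refine surjective_of_mkQ_comp_surjective (I := I) ?_
    rw [← LinearMap.range_eq_top, LinearMap.range_comp, Fintype.range_linearCombination, hs,
      ← (Submodule.comap_injective_of_surjective (Submodule.mkQ_surjective _)).eq_iff,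
      Submodule.comap_map_eq, Submodule.ker_mkQ, h, Submodule.comap_top]
  exact Module.Finite.of_surjective _ hsurj

/-- If a finitely generated ideal `J` satisfies `C = R + J`, then `C` is finite over `R` modulo
every power of `J`. -/
theorem Ideal.exists_fg_sup_pow_eq_top {R C : Type*} [CommRing R] [CommRing C] [Algebra R C]
    (J : Ideal C) (hJ : J.FG) (h : ∀ c : C, ∃ r : R, c - algebraMap R C r ∈ J) (n : ℕ) :
    ∃ N : Submodule R C, N.FG ∧ N ⊔ (J ^ n).restrictScalars R = ⊤ := by
  classical
  induction n with
  | zero => exact ⟨⊥, Submodule.fg_bot, by simp [Ideal.one_eq_top]⟩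
  | succ n ih =>
    obtain ⟨N, hN, hsup⟩ := ih
    obtain ⟨G, hG⟩ := hJ.pow (n := n)
    refine ⟨N ⊔ Submodule.span R G, hN.sup ⟨G, rfl⟩, eq_top_iff.2 ?_⟩
    rw [← hsup, sup_assoc]
    refine sup_le_sup_left (fun x hx ↦ ?_) N
    rw [Submodule.restrictScalars_mem, ← hG] at hx
    induction hx using Submodule.span_induction with
    | mem g hg => exact Submodule.mem_sup_left (Submodule.subset_span hg)
    | zero => exact zero_mem _
    | add _ _ _ _ hx hy => exact add_mem hx hy
    | smul c x hx' hx =>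
      obtain ⟨r, hr⟩ := h c
      -- The first term stays in the span of the generators of Jⁿ; the second gains a factor from J.
      have : c • x = r • x + (c - algebraMap R C r) * x := by
        rw [Algebra.smul_def r x, smul_eq_mul]; ring
      rw [this]
      refine add_mem (Submodule.smul_mem _ r hx) (Submodule.mem_sup_right ?_)
      rw [Submodule.restrictScalars_mem, pow_succ', ← hG]
      exact Ideal.mul_mem_mul hr hx'

/-- A Noetherian local algebra over a complete local ring, without residue field extension,
whose maximal ideal is the only prime containing the extension of the maximal ideal,
is module-finite. -/
theorem IsLocalRing.finite_of_isPrecomplete {R C : Type*} [CommRing R] [CommRing C]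
    [IsLocalRing R] [IsLocalRing C] [Algebra R C] [IsNoetherianRing C]
    [IsPrecomplete (maximalIdeal R) R]
    (hres : ∀ c : C, ∃ r : R, c - algebraMap R C r ∈ maximalIdeal C)
    (hrad : maximalIdeal C ≤ ((maximalIdeal R).map (algebraMap R C)).radical)
    (hne : (maximalIdeal R).map (algebraMap R C) ≠ ⊤) : Module.Finite R C := by
  have : IsHausdorff (maximalIdeal R) C :=
    IsHausdorff.map_algebraMap_iff.1 (IsHausdorff.of_isLocalRing _ C hne)
  obtain ⟨n, hn⟩ := Ideal.exists_pow_le_of_le_radical_of_fg hrad (IsNoetherian.noetherian _)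
  obtain ⟨N, hN, hsup⟩ :=
    (maximalIdeal C).exists_fg_sup_pow_eq_top (IsNoetherian.noetherian _) hres n
  refine Module.Finite.of_isPrecomplete_of_isHausdorff (maximalIdeal R) N hN ?_
  rw [eq_top_iff, Ideal.smul_top_eq_map, ← hsup]
  exact sup_le_sup_left (fun x hx ↦ hn hx) N

/-! ### Dimension theory and going down -/

/-- The Krull dimension of an integral algebra is at most that of the base. -/
theorem ringKrullDim_le_of_isIntegral (A C : Type*) [CommRing A] [CommRing C] [Algebra A C]
    [Algebra.IsIntegral A C] : ringKrullDim C ≤ ringKrullDim A :=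
  Order.krullDim_le_of_strictMono (PrimeSpectrum.comap (algebraMap A C)) fun _ Q h ↦
    Ideal.IsIntegral.comap_lt_comap (R := A) (J := Q.asIdeal) h

/-- An integral algebra over a Noetherian local domain of at least the same dimension is
faithful. -/
theorem Algebra.IsIntegral.algebraMap_injective_of_ringKrullDim_le (A C : Type*) [CommRing A]
    [CommRing C] [Algebra A C] [Algebra.IsIntegral A C] [IsDomain A] [IsNoetherianRing A]
    [IsLocalRing A] (h : ringKrullDim A ≤ ringKrullDim C) :
    Function.Injective (algebraMap A C) := by
  rw [injective_iff_map_eq_zero]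
  intro a ha
  by_contra ha0
  let I := RingHom.ker (algebraMap A C)
  let _ : Algebra (A ⧸ I) C := (RingHom.kerLift (algebraMap A C)).toAlgebra
  have : IsScalarTower A (A ⧸ I) C := IsScalarTower.of_algebraMap_eq fun _ ↦ rfl
  have : Algebra.IsIntegral (A ⧸ I) C := Algebra.IsIntegral.tower_top A
  have h1 := ringKrullDim_le_of_isIntegral (A ⧸ I) C
  have h2 : ringKrullDim (A ⧸ I) + 1 ≤ ringKrullDim A :=
    ringKrullDim_succ_le_of_surjective (Ideal.Quotient.mk I) Ideal.Quotient.mk_surjective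
      (mem_nonZeroDivisors_of_ne_zero ha0) (Ideal.Quotient.eq_zero_iff_mem.2 ha)
  -- This reads dim A + 1 ≤ dim A, absurd because a Noetherian local ring has finite dimension.
  have h3 := (add_le_add_left (h.trans h1) 1).trans h2
  have hfin := ringKrullDim_lt_top (R := A)
  have hbot := ringKrullDim_ne_bot (R := A)
  generalize ringKrullDim A = d at *
  induction d with
  | bot => exact hbot rfl
  | coe d =>
    induction d with
    | top => exact hfin.ne rfl
    | coe d =>
      norm_cast at h3
      omega

/-- If `A → B` is a local homomorphism of Noetherian local rings with going down, then cutting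
down `B` by parameters of the closed fibre gives a quotient of dimension at least `dim A` whose
closed fibre is zero-dimensional. -/
theorem Algebra.HasGoingDown.exists_ideal_ringKrullDim_le (A B : Type*) [CommRing A] [CommRing B]
    [Algebra A B] [IsLocalRing A] [IsLocalRing B] [IsNoetherianRing A] [IsNoetherianRing B]
    [(maximalIdeal B).LiesOver (maximalIdeal A)] [Algebra.HasGoingDown A B] :
    ∃ J : Ideal B, J ≤ maximalIdeal B ∧ ringKrullDim A ≤ ringKrullDim (B ⧸ J) ∧
      maximalIdeal B ≤ (J ⊔ (maximalIdeal A).map (algebraMap A B)).radical := by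
  classical
  have hht := Ideal.height_eq_height_add_of_liesOver_of_hasGoingDown (maximalIdeal A)
    (maximalIdeal B)
  set I := (maximalIdeal A).map (algebraMap A B) with hI
  have hIle : I ≤ maximalIdeal B := by
    rw [Ideal.map_le_iff_le_comap]
    exact (Ideal.over_def (maximalIdeal B) (maximalIdeal A)).le
  have hP : ((maximalIdeal B).map (Ideal.Quotient.mk I)).IsPrime :=
    Ideal.isPrime_map_quotientMk_of_isPrime hIle
  -- A system of parameters of the closed fibre: its maximal ideal is minimal over s, and s has as
  -- many elements as its height.
  obtain ⟨s, hs, hcard⟩ := Ideal.exists_finset_card_eq_height_of_isNoetherianRing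
    ((maximalIdeal B).map (Ideal.Quotient.mk I))
  let t : Finset B := s.image (Function.surjInv Ideal.Quotient.mk_surjective)
  have htmk : Ideal.Quotient.mk I '' (t : Set B) = s := by
    rw [Finset.coe_image, ← Set.image_comp]
    exact (Set.image_congr fun x _ ↦ Function.surjInv_eq Ideal.Quotient.mk_surjective x).trans
      (Set.image_id _)
  have htmax : (t : Set B) ⊆ maximalIdeal B := by
    intro x hx
    have h1 : Ideal.Quotient.mk I x ∈ (maximalIdeal B).map (Ideal.Quotient.mk I) :=
      hs.1.2 (Ideal.subset_span (htmk ▸ Set.mem_image_of_mem _ hx))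
    rwa [Ideal.mem_quotient_iff_mem hIle] at h1
  refine ⟨Ideal.span t, Ideal.span_le.2 htmax, ?_, ?_⟩
  -- Each element of t lowers the dimension by at most one, and going down gives dim B = dim A plus
  -- the height in the fibre; that height cancels.
  · have h1 := ringKrullDim_le_ringKrullDim_quotient_add_card t
      (htmax.trans (IsLocalRing.ringJacobson_eq_maximalIdeal B).ge)
    rw [← maximalIdeal_height_eq_ringKrullDim, hht, ← hcard] at h1
    have h2 : (t.card : WithBot ℕ∞) ≤ s.card := by exact_mod_cast Finset.card_image_le
    have h3 := h1.trans (add_le_add_right h2 _)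
    rw [← maximalIdeal_height_eq_ringKrullDim]
    push_cast at h3
    generalize ringKrullDim (B ⧸ Ideal.span (t : Set B)) = d at *
    generalize (maximalIdeal A).height = e at *
    generalize s.card = k at *
    induction d with
    | bot => simp at h3
    | coe d =>
      norm_cast at h3 ⊢
      exact (ENat.add_le_add_iff_right (ENat.natCast_ne_top k)).1 h3
  · rw [Ideal.radical_eq_sInf]
    refine le_sInf fun P ⟨hP, hPp⟩ ↦ ?_
    have hIP : I ≤ P := le_sup_right.trans hP
    have hP' : (Ideal.map (Ideal.Quotient.mk I) P).IsPrime :=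
      Ideal.isPrime_map_quotientMk_of_isPrime hIP
    have hsP : Ideal.span (s : Set (B ⧸ I)) ≤ Ideal.map (Ideal.Quotient.mk I) P := by
      rw [← htmk, ← Ideal.map_span]
      exact Ideal.map_mono (le_sup_left.trans hP)
    have h1 := hs.2 ⟨hP', hsP⟩ (Ideal.map_mono (IsLocalRing.le_maximalIdeal hPp.ne_top))
    intro x hx
    have h2 := h1 (Ideal.mem_map_of_mem (Ideal.Quotient.mk I) hx)
    rwa [Ideal.mem_quotient_iff_mem hIP] at h2

/-! ### A prime over the support with integral quotient -/

/-- The residue class of `x` modulo `I` lies in the maximal ideal if and only if `x` does. -/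
theorem IsLocalRing.mk_mem_maximalIdeal_iff {R : Type*} [CommRing R] [IsLocalRing R] {I : Ideal R}
    [IsLocalRing (R ⧸ I)] (x : R) :
    Ideal.Quotient.mk I x ∈ maximalIdeal (R ⧸ I) ↔ x ∈ maximalIdeal R := by
  have := IsLocalHom.of_surjective (Ideal.Quotient.mk I) Ideal.Quotient.mk_surjective
  rw [← maximalIdeal_comap (Ideal.Quotient.mk I), Ideal.mem_comap]

/-- Going down is inherited by the quotient by an ideal of the base. -/
theorem Algebra.HasGoingDown.quotient_map {R S : Type*} [CommRing R] [CommRing S] [Algebra R S]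
    [Algebra.HasGoingDown R S] (I : Ideal R) :
    Algebra.HasGoingDown (R ⧸ I) (S ⧸ I.map (algebraMap R S)) := by
  refine ⟨fun {p} hp Q hQ hlt ↦ ?_⟩
  have hcomm (r : R) : algebraMap (R ⧸ I) (S ⧸ I.map (algebraMap R S)) (Ideal.Quotient.mk I r) =
      Ideal.Quotient.mk _ (algebraMap R S r) := rfl
  let p' := p.comap (Ideal.Quotient.mk I)
  let Q' := Q.comap (Ideal.Quotient.mk (I.map (algebraMap R S)))
  have hle : p' ≤ Q'.under R := fun r hr ↦ hlt.le hr
  obtain ⟨P, hPQ, hP, hPp⟩ := Ideal.exists_ideal_le_liesOver_of_le Q' hle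
  have hIP : I.map (algebraMap R S) ≤ P := by
    rw [Ideal.map_le_iff_le_comap, ← Ideal.under_def, ← hPp.over]
    intro r hr
    change Ideal.Quotient.mk I r ∈ p
    rw [Ideal.Quotient.eq_zero_iff_mem.2 hr]
    exact zero_mem _
  refine ⟨P.map (Ideal.Quotient.mk _), ?_, Ideal.isPrime_map_quotientMk_of_isPrime hIP, ⟨?_⟩⟩
  · exact Ideal.map_le_iff_le_comap.2 hPQ
  · ext x
    obtain ⟨r, rfl⟩ := Ideal.Quotient.mk_surjective x
    rw [Ideal.under_def, Ideal.mem_comap, hcomm, Ideal.mem_quotient_iff_mem hIP]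
    exact SetLike.ext_iff.1 hPp.over r

/-- Let `R → S` be a local homomorphism of Noetherian local rings with going down and without
residue field extension, where `R` is complete. Every prime of `R` is the contraction of a prime
`q` of `S` such that `S ⧸ q` is integral over `R`. -/
theorem Ideal.exists_comap_eq_isIntegral_quotient {R S : Type*} [CommRing R] [CommRing S]
    [IsLocalRing R] [IsLocalRing S] [Algebra R S] [IsNoetherianRing R] [IsNoetherianRing S]
    [IsPrecomplete (maximalIdeal R) R] [Algebra.HasGoingDown R S]
    (hm : (maximalIdeal S).comap (algebraMap R S) = maximalIdeal R)
    (hres : ∀ s : S, ∃ r : R, s - algebraMap R S r ∈ maximalIdeal S)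
    (p : Ideal R) [hp : p.IsPrime] :
    ∃ q : Ideal S, q.IsPrime ∧ q.comap (algebraMap R S) = p ∧ Algebra.IsIntegral R (S ⧸ q) := by
  let pS := p.map (algebraMap R S)
  have hpS : pS ≤ maximalIdeal S := by
    rw [Ideal.map_le_iff_le_comap, hm]
    exact le_maximalIdeal hp.ne_top
  have : Nontrivial (S ⧸ pS) :=
    Ideal.Quotient.nontrivial_iff.2 (ne_top_of_le_ne_top (maximalIdeal.isMaximal S).ne_top hpS)
  have : IsLocalRing (R ⧸ p) := .of_surjective' (Ideal.Quotient.mk p) Ideal.Quotient.mk_surjective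
  have : IsLocalRing (S ⧸ pS) :=
    .of_surjective' (Ideal.Quotient.mk pS) Ideal.Quotient.mk_surjective
  have : (maximalIdeal (S ⧸ pS)).LiesOver (maximalIdeal (R ⧸ p)) := by
    refine ⟨?_⟩
    ext x
    obtain ⟨r, rfl⟩ := Ideal.Quotient.mk_surjective x
    rw [mk_mem_maximalIdeal_iff, ← hm]
    exact (mk_mem_maximalIdeal_iff _).symm
  have := Algebra.HasGoingDown.quotient_map (S := S) p
  obtain ⟨J, hJ, hdim, hrad⟩ := Algebra.HasGoingDown.exists_ideal_ringKrullDim_le (R ⧸ p) (S ⧸ pS)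
  let C := (S ⧸ pS) ⧸ J
  have : Nontrivial C :=
    Ideal.Quotient.nontrivial_iff.2 (ne_top_of_le_ne_top (maximalIdeal.isMaximal _).ne_top hJ)
  have : IsLocalRing C := .of_surjective' (Ideal.Quotient.mk J) Ideal.Quotient.mk_surjective
  have : Module.Finite R C := by
    have hle : (maximalIdeal R).map (algebraMap R C) ≤ maximalIdeal C := by
      rw [Ideal.map_le_iff_le_comap]
      intro r hr
      rw [← hm] at hr
      exact (mk_mem_maximalIdeal_iff _).2 ((mk_mem_maximalIdeal_iff _).2 hr)
    refine IsLocalRing.finite_of_isPrecomplete (fun c ↦ ?_) (fun c hc ↦ ?_)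
      (ne_top_of_le_ne_top (maximalIdeal.isMaximal C).ne_top hle)
    · obtain ⟨b, rfl⟩ := Ideal.Quotient.mk_surjective c
      obtain ⟨s, rfl⟩ := Ideal.Quotient.mk_surjective b
      obtain ⟨r, hr⟩ := hres s
      exact ⟨r, (mk_mem_maximalIdeal_iff _).2 ((mk_mem_maximalIdeal_iff _).2 hr)⟩
    · obtain ⟨b, rfl⟩ := Ideal.Quotient.mk_surjective c
      obtain ⟨n, hn⟩ := hrad ((mk_mem_maximalIdeal_iff _).1 hc)
      refine ⟨n, ?_⟩
      have h1 := Ideal.mem_map_of_mem (Ideal.Quotient.mk J) hn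
      rw [map_pow, Ideal.map_sup, Ideal.map_quotient_self, bot_sup_eq, Ideal.map_map] at h1
      refine Ideal.map_le_iff_le_comap.2 ?_ h1
      intro x hx
      obtain ⟨r, rfl⟩ := Ideal.Quotient.mk_surjective x
      exact Ideal.mem_map_of_mem (algebraMap R C) ((mk_mem_maximalIdeal_iff _).1 hx)
  have : IsScalarTower R (R ⧸ p) C := IsScalarTower.of_algebraMap_eq fun _ ↦ rfl
  have : Algebra.IsIntegral (R ⧸ p) C := Algebra.IsIntegral.tower_top R
  have hinj := Algebra.IsIntegral.algebraMap_injective_of_ringKrullDim_le (R ⧸ p) C hdim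
  obtain ⟨Q, -, hQ, hQp⟩ := Ideal.exists_ideal_over_prime_of_isIntegral (⊥ : Ideal (R ⧸ p))
    (⊥ : Ideal C) ((RingHom.injective_iff_ker_eq_bot _).1 hinj).le
  -- Its kernel is the required q: S/q embeds in C/Q, which is integral over R.
  let f : S →ₐ[R] C ⧸ Q := IsScalarTower.toAlgHom R S (C ⧸ Q)
  refine ⟨RingHom.ker f, RingHom.ker_isPrime _, ?_, ?_⟩
  · ext r
    have h1 : r ∈ (RingHom.ker f).comap (algebraMap R S) ↔
        Ideal.Quotient.mk p r ∈ Q.comap (algebraMap (R ⧸ p) C) := by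
      rw [Ideal.mem_comap, RingHom.mem_ker, Ideal.mem_comap, ← Ideal.Quotient.eq_zero_iff_mem]
      rfl
    rw [h1, hQp, Ideal.mem_bot, Ideal.Quotient.eq_zero_iff_mem]
  · have : Algebra.IsIntegral R (C ⧸ Q) := inferInstance
    exact Algebra.IsIntegral.of_injective (Ideal.kerLiftAlg f) (Ideal.kerLiftAlg_injective f)

/-! ### The extension theorem -/

theorem theoremT {R S : Type*} [CommRing R] [CommRing S] [IsLocalRing R] [IsLocalRing S]
    [Algebra R S] (hRS : Function.Injective (algebraMap R S))
    (hm : (IsLocalRing.maximalIdeal S).comap (algebraMap R S) = IsLocalRing.maximalIdeal R)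
    (v : RealValuation R) (hv : RealValuation.IsNonneg v)
    (h : Algebra.IsIntegral R S ∨
      (IsNoetherianRing R ∧ IsNoetherianRing S ∧
        IsAdicComplete (IsLocalRing.maximalIdeal R) R ∧
        IsAdicComplete (IsLocalRing.maximalIdeal S) S ∧
        Module.Flat R S ∧
        Function.Bijective
          (Ideal.quotientMap (I := IsLocalRing.maximalIdeal R) (IsLocalRing.maximalIdeal S)
            (algebraMap R S) hm.ge) ∧
        ((IsLocalRing.maximalIdeal R).map (algebraMap R S)).IsPrime)) :
    (∃ w : RealValuation S, RealValuation.IsNonneg w ∧ RealValuation.Extends w v) ∧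
    (RealValuation.IsLocal v →
      ∃ w : RealValuation S, RealValuation.IsLocal w ∧ RealValuation.Extends w v) ∧
    (Algebra.IsIntegral R S → ∀ w : RealValuation S, RealValuation.Extends w v →
      RealValuation.IsNonneg w ∧ (RealValuation.IsLocal v → RealValuation.IsLocal w)) := by
  have hprime := RealValuation.isPrime_supp v
  have hq : ∃ q : Ideal S, q.IsPrime ∧ q.comap (algebraMap R S) = v.supp ∧
      Algebra.IsIntegral R (S ⧸ q) := by
    rcases h with h | ⟨_, _, _, _, _, hbij, _⟩
    · obtain ⟨q, -, hq, hqv⟩ := Ideal.exists_ideal_over_prime_of_isIntegral v.supp (⊥ : Ideal S)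
        (((RingHom.injective_iff_ker_eq_bot _).1 hRS).le.trans bot_le)
      exact ⟨q, hq, hqv, inferInstance⟩
    -- Going down is inferred from flatness; surjectivity on residue fields supplies the
    -- approximation of s by an element of R.
    · refine Ideal.exists_comap_eq_isIntegral_quotient hm (fun s ↦ ?_) v.supp
      obtain ⟨x, hx⟩ := hbij.2 (Ideal.Quotient.mk _ s)
      obtain ⟨r, rfl⟩ := Ideal.Quotient.mk_surjective x
      exact ⟨r, Ideal.Quotient.eq.1 hx.symm⟩
  obtain ⟨q, hqp, hqv, hint⟩ := hq
  obtain ⟨w, hw⟩ := RealValuation.exists_extends_of_isIntegral_quotient v q hqv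
  refine ⟨⟨w.comap (Ideal.Quotient.mk q), fun f ↦ hv.of_extends hw _, hw⟩,
    fun hvl ↦ ⟨w.comap (Ideal.Quotient.mk q), ⟨fun f ↦ hv.of_extends hw _, fun f hf ↦ ?_⟩, hw⟩,
    fun _ u hu ↦ ⟨hv.of_extends hu, fun hvl ↦ hvl.of_extends hu⟩⟩
  have : IsLocalRing (S ⧸ q) := .of_surjective' (Ideal.Quotient.mk q) Ideal.Quotient.mk_surjective
  exact (hvl.of_extends hw).2 _ ((IsLocalRing.mk_mem_maximalIdeal_iff _).2 hf)
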